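/- Simple types are built from a single ground type $o$ by $\sigma \to \tau$. For a type $\alpha$ let $\omega_\alpha = (\alpha\to\alpha)\to(\alpha\to\alpha)$, and for $n\in\mathbb{N}$ let $\underline{n}_\alpha = \lambda f^{\alpha\to\alpha}.\lambda x^{\alpha}. f^n(x)$ be the Church numeral for $n$ at $\alpha$. In an extension $\lambda^+$ of the typed $\lambda\beta\eta$-calculus, a function $g:\mathbb{N}\to\mathbb{N}$ is $\alpha$-definable if there is a closed $\lambda^+$-term $F:\omega_\alpha\to\omega_\alpha$ such that, for all $n,k\in\mathbb{N}$, $$g(n) = k \iff \ \vdash_{\lambda^+} F\,\underline{n}_\alpha = \underline{k}_\alpha .$$ Let $\mathcal{O}_o=\{\bot<\top\}$ and let $\mathcal{O}_{\sigma\to\tau}$ be the (finite) set of monotone functions $\mathcal{O}_\sigma\to\mathcal{O}_\tau$, ordered pointwise. Let $h(\sigma)$ be the height of the longest ascending chain in $\mathcal{O}_\sigma$, i.e. the largest $n$ for which there are $x_0<x_1<\dots<x_n$ in $\mathcal{O}_\sigma$. For $m \in\mathbb{N}$ define $e_m:\mathbb{N}\to\mathbb{N}$ by $e_m(m)=1$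 and $e_m(n)=0$ for $n\neq m$. **Fact.** For every type $\alpha$ and every $m > h(\alpha\to\alpha)$, the function $e_m$ is not $\alpha$-definable: neither in the typed $\lambda\beta\eta$-calculus, nor in the $\lambda\Omega$-calculus (the $\lambda\beta\eta$-calculus with a constant $\Omega:o$ and no further conversions), nor in the $\lambda\Omega^+$-calculus (constants $\Omega_\sigma:\sigma$ for every type $\sigma$ and no further conversions), nor in the $\lambda\mathrm{Y}$-calculus (constants $\mathrm{Y}_\sigma:(\sigma\to\sigma)\to\sigma$ for every type $\sigma$, with the conversions $f(\mathrm{Y}_\sigma f)=\mathrm{Y}_\sigma f$). -/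

import Mathlib

namespace LambdaCalc

/-- Simple types over a single ground type `o`. -/
inductive Ty : Type
  | o : Ty
  | arrow : Ty → Ty → Ty

/-- Typed de Bruijn variables: `Var Γ σ` is the type of variables of type `σ` in the context `Γ`. -/
inductive Var : List Ty → Ty → Type
  | zero {Γ : List Ty} {σ : Ty} : Var (σ :: Γ) σ
  | succ {Γ : List Ty} {σ τ : Ty} : Var Γ σ → Var (τ :: Γ) σ

/-- Typed lambda terms (up to renaming of bound variables), with constants from the family `C`;
`Term C Γ σ` is the type of terms of type `σ` with free variables from `Γ`. -/
inductive Term (C : Ty → Type) : List Ty → Ty → Type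
  | var {Γ : List Ty} {σ : Ty} : Var Γ σ → Term C Γ σ
  | const {Γ : List Ty} {σ : Ty} : C σ → Term C Γ σ
  | lam {Γ : List Ty} {σ τ : Ty} : Term C (σ :: Γ) τ → Term C Γ (σ.arrow τ)
  | app {Γ : List Ty} {σ τ : Ty} : Term C Γ (σ.arrow τ) → Term C Γ σ → Term C Γ τ

/-- A renaming, extended under a binder. -/
def liftRen {Γ Δ : List Ty} {τ : Ty} (r : ∀ σ, Var Γ σ → Var Δ σ) :
    ∀ σ, Var (τ :: Γ) σ → Var (τ :: Δ) σ
  | _, .zero => .zero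
  | _, .succ x => .succ (r _ x)

/-- Renaming of the free variables of a term. -/
def Term.rename {C : Ty → Type} : {Γ : List Ty} → {σ : Ty} → Term C Γ σ → {Δ : List Ty} →
    (∀ τ, Var Γ τ → Var Δ τ) → Term C Δ σ
  | _, _, .var x, _, r => .var (r _ x)
  | _, _, .const c, _, _ => .const c
  | _, _, .lam M, _, r => .lam (M.rename (liftRen r))
  | _, _, .app M N, _, r => .app (M.rename r) (N.rename r)

/-- Weakening by one (unused) variable. -/
def Term.weaken {C : Ty → Type} {Γ : List Ty} {σ τ : Ty} (M : Term C Γ σ) : Term C (τ :: Γ) σ :=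
  M.rename (fun _ x => .succ x)

/-- A simultaneous substitution, extended under a binder. -/
def liftSubst {C : Ty → Type} {Γ Δ : List Ty} {τ : Ty} (s : ∀ σ, Var Γ σ → Term C Δ σ) :
    ∀ σ, Var (τ :: Γ) σ → Term C (τ :: Δ) σ
  | _, .zero => .var .zero
  | _, .succ x => (s _ x).weaken

/-- Simultaneous capture-avoiding substitution. -/
def Term.subst {C : Ty → Type} : {Γ : List Ty} → {σ : Ty} → Term C Γ σ → {Δ : List Ty} →
    (∀ τ, Var Γ τ → Term C Δ τ) → Term C Δ σ
  | _, _, .var x, _, s => s _ x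
  | _, _, .const c, _, _ => .const c
  | _, _, .lam M, _, s => .lam (M.subst (liftSubst s))
  | _, _, .app M N, _, s => .app (M.subst s) (N.subst s)

/-- The substitution of `N` for the last variable, the other variables being left alone. -/
def singleSubst {C : Ty → Type} {Γ : List Ty} {τ : Ty} (N : Term C Γ τ) :
    ∀ σ, Var (τ :: Γ) σ → Term C Γ σ
  | _, .zero => N
  | _, .succ x => .var x

/-- An extension of the typed lambda-beta-eta-calculus: a family of constants, together with
additional conversion rules. -/
structure Calculus where
  /-- the constants of each type -/
  Const : Ty → Type
  /-- the additional conversions -/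
  Ax : ∀ {Γ : List Ty} {σ : Ty}, Term Const Γ σ → Term Const Γ σ → Prop

/-- Provable equality in the calculus `L`: the least congruence that contains the beta
conversions, the eta conversions and the additional conversions of `L`. -/
inductive Calculus.Eqn (L : Calculus) :
    {Γ : List Ty} → {σ : Ty} → Term L.Const Γ σ → Term L.Const Γ σ → Prop
  | refl {Γ : List Ty} {σ : Ty} (M : Term L.Const Γ σ) : L.Eqn M M
  | symm {Γ : List Ty} {σ : Ty} {M N : Term L.Const Γ σ} : L.Eqn M N → L.Eqn N M
  | trans {Γ : List Ty} {σ : Ty} {M N P : Term L.Const Γ σ} : L.Eqn M N → L.Eqn N P → L.Eqn M P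
  | lam {Γ : List Ty} {σ τ : Ty} {M N : Term L.Const (σ :: Γ) τ} :
      L.Eqn M N → L.Eqn (.lam M) (.lam N)
  | app {Γ : List Ty} {σ τ : Ty} {M M' : Term L.Const Γ (σ.arrow τ)} {N N' : Term L.Const Γ σ} :
      L.Eqn M M' → L.Eqn N N' → L.Eqn (.app M N) (.app M' N')
  | beta {Γ : List Ty} {σ τ : Ty} (M : Term L.Const (σ :: Γ) τ) (N : Term L.Const Γ σ) :
      L.Eqn (.app (.lam M) N) (M.subst (singleSubst N))
  | eta {Γ : List Ty} {σ τ : Ty} (M : Term L.Const Γ (σ.arrow τ)) :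
      L.Eqn (.lam (.app M.weaken (.var .zero))) M
  | ax {Γ : List Ty} {σ : Ty} {M N : Term L.Const Γ σ} : L.Ax M N → L.Eqn M N

/-- The empty family of constants. -/
inductive NoConst : Ty → Type

/-- A single constant `Ω` of ground type. -/
inductive OmegaConst : Ty → Type
  | Omega : OmegaConst .o

/-- A constant `Ω_σ` of every type `σ`. -/
inductive OmegaPlusConst : Ty → Type
  | Omega (σ : Ty) : OmegaPlusConst σ

/-- A recursion operator `Y_σ : (σ → σ) → σ` for every type `σ`. -/
inductive YConst : Ty → Type
  | Y (σ : Ty) : YConst ((σ.arrow σ).arrow σ)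

/-- The conversions `M (Y_σ M) = Y_σ M`. -/
inductive YAx : {Γ : List Ty} → {σ : Ty} → Term YConst Γ σ → Term YConst Γ σ → Prop
  | unfold {Γ : List Ty} {σ : Ty} (M : Term YConst Γ (σ.arrow σ)) :
      YAx (.app M (.app (.const (.Y σ)) M)) (.app (.const (.Y σ)) M)

/-- The typed lambda-beta-eta-calculus. -/
def lambdaBetaEta : Calculus := ⟨NoConst, fun _ _ => False⟩

/-- The lambda-Omega-calculus: a ground type constant, no additional conversions. -/
def lambdaOmega : Calculus := ⟨OmegaConst, fun _ _ => False⟩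

/-- The lambda-Omega-plus-calculus: a constant of every type, no additional conversions. -/
def lambdaOmegaPlus : Calculus := ⟨OmegaPlusConst, fun _ _ => False⟩

/-- The lambda-Y-calculus: recursion operators at all types, with their conversions. -/
def lambdaY : Calculus := ⟨YConst, YAx⟩

/-- The type `ω_α = (α → α) → (α → α)` of numerals at `α`. -/
def numTy (α : Ty) : Ty := (α.arrow α).arrow (α.arrow α)

/-- `f^m(x)`, the `m`-fold application of the term `f` to the term `x`. -/
def iterApp {C : Ty → Type} {Γ : List Ty} {α : Ty} (f : Term C Γ (α.arrow α)) :
    ℕ → Term C Γ α → Term C Γ α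
  | 0, x => x
  | m + 1, x => .app f (iterApp f m x)

/-- The Church numeral `λ f x. f^m(x)` at `α`. -/
def numeral (C : Ty → Type) (α : Ty) (m : ℕ) : Term C [] (numTy α) :=
  .lam (.lam (iterApp (.var (.succ .zero)) m (.var .zero)))

/-- The type `ω_{α₁} → ⋯ → ω_{α_k} → ω_α`. -/
def numFnTy : (k : ℕ) → (Fin k → Ty) → Ty → Ty
  | 0, _, α => numTy α
  | k + 1, αs, α => (numTy (αs 0)).arrow (numFnTy k (fun i => αs i.succ) α)

/-- The application of `F` to the numerals for `m₁, …, m_k` at `α₁, …, α_k`. -/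
def applyNumerals {C : Ty → Type} : (k : ℕ) → (αs : Fin k → Ty) → (α : Ty) →
    Term C [] (numFnTy k αs α) → (Fin k → ℕ) → Term C [] (numTy α)
  | 0, _, _, F, _ => F
  | k + 1, αs, α, F, ms =>
      applyNumerals k (fun i => αs i.succ) α (.app F (numeral C (αs 0) (ms 0)))
        (fun i => ms i.succ)

/-- In the calculus `L`, the closed term `F` `(α₁, …, α_k, α)`-defines the partial function `f`. -/
def Defines (L : Calculus) {k : ℕ} (αs : Fin k → Ty) (α : Ty)
    (F : Term L.Const [] (numFnTy k αs α)) (f : (Fin k → ℕ) →. ℕ) : Prop :=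
  ∀ (ms : Fin k → ℕ) (m : ℕ),
    m ∈ f ms ↔ L.Eqn (applyNumerals k αs α F ms) (numeral L.Const α m)

/-- The partial function `f` is `α`-definable in the calculus `L`. -/
def Definable (L : Calculus) (α : Ty) {k : ℕ} (f : (Fin k → ℕ) →. ℕ) : Prop :=
  ∃ F : Term L.Const [] (numFnTy k (fun _ => α) α), Defines L (fun _ => α) α F f

/-- The function with value `1` at `m` and value `0` elsewhere. -/
def e (m n : ℕ) : ℕ := if n = m then 1 else 0

/-- A function of one variable, as a (total) partial function of a tuple of length one. -/
def unary (f : ℕ → ℕ) : (Fin 1 → ℕ) →. ℕ := fun ms => Part.some (f (ms 0))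

/-- The hierarchy of monotone functions over the two-element chain (Sierpinski space), each
domain being ordered pointwise. The domains are finite, so monotone and continuous functions
coincide. -/
def O : Ty → PartOrd.{0}
  | .o => PartOrd.of Bool
  | .arrow σ τ => PartOrd.of (O σ →o O τ)

/-- The height of the longest ascending chain `x₀ < x₁ < ⋯ < x_n` in `O σ`, that is, the
largest possible number `n` of steps. -/
noncomputable def h (σ : Ty) : ℕ := sSup (Set.range (fun p : LTSeries (O σ) => p.length))

theorem finite_O (σ : Ty) : Finite (O σ) := by
  induction σ with
  | o => exact inferInstanceAs (Finite Bool)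
  | arrow σ τ ihσ ihτ =>
    exact Finite.of_injective (β := O σ → O τ)
      (fun f => ((show O σ →o O τ from f) : O σ → O τ)) (fun f g hfg => OrderHom.ext _ _ hfg)

theorem nonempty_O (σ : Ty) : Nonempty (O σ) := by
  induction σ with
  | o => exact ⟨(false : Bool)⟩
  | arrow σ τ _ ihτ => exact ihτ.elim fun x => ⟨(OrderHom.const (O σ) x : O σ →o O τ)⟩

/-- The supremum in the definition of `h` is attained. -/
theorem h_isGreatest (σ : Ty) : IsGreatest (Set.range (fun p : LTSeries (O σ) => p.length)) (h σ) := by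
  have := finite_O σ
  have := Fintype.ofFinite (O σ)
  have hb : BddAbove (Set.range (fun p : LTSeries (O σ) => p.length)) := by
    refine ⟨Fintype.card (O σ), ?_⟩
    rintro _ ⟨p, rfl⟩
    exact (p.length_lt_card).le
  obtain ⟨x⟩ := nonempty_O σ
  have hn : (Set.range (fun p : LTSeries (O σ) => p.length)).Nonempty :=
    ⟨_, RelSeries.singleton _ x, rfl⟩
  exact ⟨Nat.sSup_mem hn hb, fun _ hy => le_csSup hb hy⟩

end LambdaCalc

/-!
The monotone hierarchy `O` is a finite model of all four calculi: `Ω_σ` is interpreted by the least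
element of `O σ`, and `Y_σ` by the least fixed point operator, which on the finite poset `O σ` is
iteration from the least element (`Term.eval`, `Calculus.Eqn.eval_eq`).

Let `N` be the cardinality of `O α`. In the model, the numeral `n` sends `f` to `f^n`, and for a
self-map of a set with `N` elements the sequence of powers is periodic, with period dividing `N!`,
from the exponent `N` on (`iterate_add_factorial_card`). Hence the numerals `n` and `n + N!` have
the same value as soon as `N ≤ n`, and a term defining `e_m` with `N ≤ m` would force the numerals
`e_m(m) = 1` and `e_m(m + N!) = 0` to have the same value, that is, every monotone self-map of
`O α` to be the identity. This is absurd, since `O α` has two distinct elements.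

It remains to see that `N ≤ h (α → α)` (`card_le_h`). If the elements of `O α` are listed along a
linear extension of the order, each final segment is an upper set. The functions which take one of
two values `b < t`, namely `t` exactly on such a segment, form a chain of `N + 1` monotone
functions.
-/

namespace LambdaCalc

/-! ### Iterates of a self-map of a finite set -/

/-- The orbit of `x` enters its cycle after fewer than `N` steps and the length of the cycle
divides `N!`, where `N` is the cardinality of the set. -/
theorem iterate_add_factorial_card {X : Type*} [Finite X] (f : X → X) (x : X) {n : ℕ}
    (hn : Nat.card X ≤ n) : f^[n + (Nat.card X).factorial] x = f^[n] x := by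
  have := Fintype.ofFinite X
  rw [Nat.card_eq_fintype_card] at *
  obtain ⟨i, j, hij, heq⟩ := Fintype.exists_ne_map_eq_of_card_lt
    (fun i : Fin (Fintype.card X + 1) => f^[i] x) (by simp)
  wlog hlt : i < j generalizing i j
  · exact this j i hij.symm heq.symm (lt_of_le_of_ne (not_lt.mp hlt) hij.symm)
  have hlt' : (i : ℕ) < j := hlt
  have hper : Function.IsPeriodicPt f ((j : ℕ) - i) (f^[i] x) := by
    change f^[(j : ℕ) - i] (f^[i] x) = f^[i] x
    rw [← Function.iterate_add_apply, Nat.sub_add_cancel hlt'.le]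
    exact heq.symm
  have hdvd : ((j : ℕ) - i) ∣ (Fintype.card X).factorial :=
    Nat.dvd_factorial (by omega) (by omega)
  have hper' : Function.IsPeriodicPt f ((j : ℕ) - i) (f^[n] x) := by
    have := hper.apply_iterate (n - i)
    rwa [← Function.iterate_add_apply, Nat.sub_add_cancel (by omega)] at this
  rw [Nat.add_comm, Function.iterate_add_apply]
  exact hper'.trans_dvd hdvd

/-- Starting from a least element, the iterates of a monotone map of a finite poset reach a fixed
point after as many steps as the poset has elements. -/
theorem isFixedPt_iterate_card {X : Type*} [PartialOrder X] [Finite X] (f : X →o X) {b : X}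
    (hb : ∀ x, b ≤ x) : f (f^[Nat.card X] b) = f^[Nat.card X] b := by
  have hmono : Monotone fun n => f^[n] b :=
    f.monotone.monotone_iterate_of_le_map (hb _)
  apply le_antisymm
  · calc f (f^[Nat.card X] b) = f^[Nat.card X + 1] b := (Function.iterate_succ_apply' _ _ _).symm
      _ ≤ f^[Nat.card X + (Nat.card X).factorial] b :=
        hmono (Nat.add_le_add_left (Nat.factorial_pos _) _)
      _ = f^[Nat.card X] b := iterate_add_factorial_card f b le_rfl
  · exact (hmono (Nat.le_succ _)).trans_eq (Function.iterate_succ_apply' _ _ _)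

/-! ### Chains of monotone functions -/

/-- The chain consists of the functions taking the value `t` on a final segment of a linear
extension of `X` and the value `b` elsewhere. -/
theorem exists_ltSeries_orderHom_length_eq_card {X Y : Type*} [PartialOrder X] [Finite X]
    [PartialOrder Y] {b t : Y} (hbt : b < t) :
    ∃ p : LTSeries (X →o Y), p.length = Nat.card X := by
  classical
  have := Fintype.ofFinite X
  have : Fintype (LinearExtension X) := inferInstanceAs (Fintype X)
  have hcard : Fintype.card (LinearExtension X) = Nat.card X :=
    (Nat.card_eq_fintype_card (α := LinearExtension X)).symm
  let e : LinearExtension X ≃o Fin (Nat.card X) := (Fintype.orderIsoFinOfCardEq _ hcard).symm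
  let r : X → Fin (Nat.card X) := fun x => e (toLinearExtension x)
  have hr : Monotone r := e.monotone.comp toLinearExtension.monotone
  have hsurj : Function.Surjective r := e.surjective.comp fun x => ⟨x, rfl⟩
  let g : Fin (Nat.card X + 1) → (X →o Y) := fun k =>
    ⟨fun x => if Nat.card X ≤ (r x : ℕ) + k then t else b, fun x y hxy => by
      have : (r x : ℕ) ≤ r y := hr hxy
      dsimp only
      split_ifs
      · exact le_rfl
      · omega
      · exact hbt.le
      · exact le_rfl⟩
  refine ⟨LTSeries.mk (Nat.card X) g (Fin.strictMono_iff_lt_succ.mpr fun k => ?_), rfl⟩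
  have hk := k.isLt
  refine lt_of_le_of_ne (fun x => ?_) fun heq => ?_
  · change (if Nat.card X ≤ (r x : ℕ) + (k : ℕ) then t else b)
      ≤ (if Nat.card X ≤ (r x : ℕ) + ((k : ℕ) + 1) then t else b)
    split_ifs
    · exact le_rfl
    · omega
    · exact hbt.le
    · exact le_rfl
  · -- The two functions differ at the element of rank `card X - 1 - k`.
    obtain ⟨x, hx⟩ := hsurj ⟨Nat.card X - 1 - k, by omega⟩
    have hx' : (r x : ℕ) = Nat.card X - 1 - k := congrArg Fin.val hx
    have h := DFunLike.congr_fun heq x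
    change (if Nat.card X ≤ (r x : ℕ) + (k : ℕ) then t else b)
      = (if Nat.card X ≤ (r x : ℕ) + ((k : ℕ) + 1) then t else b) at h
    rw [if_neg (by omega), if_pos (by omega)] at h
    exact hbt.ne h

theorem exists_lt_O (σ : Ty) : ∃ b t : O σ, b < t := by
  induction σ with
  | o => exact ⟨(false : Bool), (true : Bool), show (false : Bool) < true by decide⟩
  | arrow σ τ _ ihτ =>
    obtain ⟨b, t, hbt⟩ := ihτ
    obtain ⟨x⟩ := nonempty_O σ
    exact ⟨OrderHom.const (O σ) b, OrderHom.const (O σ) t,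
      show OrderHom.const (O σ) b < OrderHom.const (O σ) t from
        lt_of_le_not_ge (fun _ => hbt.le) fun h => hbt.not_ge (h x)⟩

theorem card_le_h (α : Ty) : Nat.card (O α) ≤ h (α.arrow α) := by
  have := finite_O α
  obtain ⟨b, t, hbt⟩ := exists_lt_O α
  obtain ⟨p, hp⟩ := exists_ltSeries_orderHom_length_eq_card (X := O α) hbt
  exact (h_isGreatest (α.arrow α)).2 ⟨p, hp⟩

/-! ### The interpretation of terms in the monotone hierarchy -/

/-- Valuations of the variables of a context in the hierarchy `O`, ordered pointwise. -/
abbrev Env (Γ : List Ty) : Type := ∀ σ, Var Γ σ → O σ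

/-- The extension of a valuation by a value for one more variable. -/
def Env.cons {Γ : List Ty} {τ : Ty} (x : O τ) (ρ : Env Γ) : Env (τ :: Γ)
  | _, .zero => x
  | _, .succ v => ρ _ v

theorem Env.cons_le_cons {Γ : List Ty} {τ : Ty} {x y : O τ} {ρ ρ' : Env Γ} (hx : x ≤ y)
    (hρ : ρ ≤ ρ') : Env.cons x ρ ≤ Env.cons y ρ'
  | _, .zero => hx
  | _, .succ v => hρ _ v

/-- The value of a term, a monotone function of the valuation of its free variables, for a given
interpretation `I` of the constants. -/
def Term.eval {C : Ty → Type} (I : ∀ σ, C σ → O σ) :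
    {Γ : List Ty} → {σ : Ty} → Term C Γ σ → (Env Γ →o O σ)
  | _, _, .var v => ⟨fun ρ => ρ _ v, fun _ _ hρ => hρ _ v⟩
  | _, _, .const c => OrderHom.const _ (I _ c)
  | _, .arrow σ τ, .lam M =>
    { toFun := fun ρ =>
        (⟨fun x => M.eval I (Env.cons x ρ),
          fun _ _ hx => (M.eval I).monotone (Env.cons_le_cons hx le_rfl)⟩ : O σ →o O τ)
      monotone' := fun _ _ hρ x => (M.eval I).monotone (Env.cons_le_cons (le_refl x) hρ) }
  | _, τ, .app (σ := σ) M N =>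
    { toFun := fun ρ => (show O σ →o O τ from M.eval I ρ) (N.eval I ρ)
      monotone' := fun ρ ρ' hρ =>
        le_trans ((show O σ →o O τ from M.eval I ρ).monotone ((N.eval I).monotone hρ))
          ((show (show O σ →o O τ from M.eval I ρ) ≤ (show O σ →o O τ from M.eval I ρ') from
            (M.eval I).monotone hρ) (N.eval I ρ')) }

section Eval

variable {C : Ty → Type} (I : ∀ σ, C σ → O σ)

theorem Term.eval_app {Γ : List Ty} {σ τ : Ty} (M : Term C Γ (σ.arrow τ)) (N : Term C Γ σ)
    (ρ : Env Γ) :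
    (Term.app M N).eval I ρ = (show O σ →o O τ from M.eval I ρ) (N.eval I ρ) := rfl

theorem Term.eval_rename {Γ : List Ty} {σ : Ty} (M : Term C Γ σ) {Δ : List Ty}
    (r : ∀ τ, Var Γ τ → Var Δ τ) (ρ : Env Δ) :
    (M.rename r).eval I ρ = M.eval I fun τ v => ρ τ (r τ v) := by
  induction M generalizing Δ with
  | var v => rfl
  | const c => rfl
  | lam M ih =>
    refine OrderHom.ext _ _ (funext fun x => ?_)
    refine (ih (liftRen r) (Env.cons x ρ)).trans (congrArg (M.eval I) ?_)
    funext τ v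
    cases v <;> rfl
  | app M N ihM ihN =>
    rw [Term.rename, Term.eval_app, Term.eval_app, ihM, ihN]

theorem Term.eval_weaken {Γ : List Ty} {σ τ : Ty} (M : Term C Γ σ) (x : O τ) (ρ : Env Γ) :
    M.weaken.eval I (Env.cons x ρ) = M.eval I ρ :=
  M.eval_rename I _ _

theorem Term.eval_subst {Γ : List Ty} {σ : Ty} (M : Term C Γ σ) {Δ : List Ty}
    (s : ∀ τ, Var Γ τ → Term C Δ τ) (ρ : Env Δ) :
    (M.subst s).eval I ρ = M.eval I fun τ v => (s τ v).eval I ρ := by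
  induction M generalizing Δ with
  | var v => rfl
  | const c => rfl
  | lam M ih =>
    refine OrderHom.ext _ _ (funext fun x => ?_)
    refine (ih (liftSubst s) (Env.cons x ρ)).trans (congrArg (M.eval I) ?_)
    funext τ v
    cases v with
    | zero => rfl
    | succ v => exact (s τ v).eval_weaken I x ρ
  | app M N ihM ihN =>
    rw [Term.subst, Term.eval_app, Term.eval_app, ihM, ihN]

theorem Term.eval_subst_singleSubst {Γ : List Ty} {σ τ : Ty} (M : Term C (σ :: Γ) τ)
    (N : Term C Γ σ) (ρ : Env Γ) :
    (M.subst (singleSubst N)).eval I ρ = M.eval I (Env.cons (N.eval I ρ) ρ) := by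
  refine (M.eval_subst I _ ρ).trans (congrArg (M.eval I) ?_)
  funext υ v
  cases v <;> rfl

theorem eval_iterApp {Γ : List Ty} {α : Ty} (f : Term C Γ (α.arrow α)) (n : ℕ) (x : Term C Γ α)
    (ρ : Env Γ) :
    (iterApp f n x).eval I ρ = (show O α →o O α from f.eval I ρ)^[n] (x.eval I ρ) := by
  induction n with
  | zero => rfl
  | succ n ih => rw [iterApp, Term.eval_app, ih, Function.iterate_succ_apply']

/-- The value of a numeral, applied to a function and an argument. -/
theorem eval_numeral (α : Ty) (n : ℕ) (ρ : Env []) (f : O α →o O α) (x : O α) :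
    (show O α →o O α from
      (show (O α →o O α) →o (O α →o O α) from (numeral C α n).eval I ρ) f) x = f^[n] x :=
  eval_iterApp I _ n _ (Env.cons x (Env.cons (τ := α.arrow α) f ρ))

theorem eval_numeral_add_factorial (α : Ty) {n : ℕ} (hn : Nat.card (O α) ≤ n) (ρ : Env []) :
    (numeral C α (n + (Nat.card (O α)).factorial)).eval I ρ = (numeral C α n).eval I ρ := by
  have := finite_O α
  refine OrderHom.ext _ _ (funext fun f => OrderHom.ext _ _ (funext fun x => ?_))
  refine (eval_numeral I α _ ρ f x).trans (.trans ?_ (eval_numeral I α _ ρ f x).symm)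
  exact iterate_add_factorial_card _ x hn

theorem eval_numeral_zero_ne_one (α : Ty) (ρ : Env []) :
    (numeral C α 0).eval I ρ ≠ (numeral C α 1).eval I ρ := by
  intro heq
  obtain ⟨b, t, hbt⟩ := exists_lt_O α
  have h0 := eval_numeral I α 0 ρ (OrderHom.const (O α) t) b
  rw [heq] at h0
  exact hbt.ne' ((eval_numeral I α 1 ρ (OrderHom.const (O α) t) b).symm.trans h0)

end Eval

/-- Soundness of the interpretation. -/
theorem Calculus.Eqn.eval_eq {L : Calculus} {I : ∀ σ, L.Const σ → O σ}
    (hI : ∀ {Γ : List Ty} {σ : Ty} {M N : Term L.Const Γ σ}, L.Ax M N →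
      ∀ ρ, M.eval I ρ = N.eval I ρ)
    {Γ : List Ty} {σ : Ty} {M N : Term L.Const Γ σ} (hMN : L.Eqn M N) (ρ : Env Γ) :
    M.eval I ρ = N.eval I ρ := by
  induction hMN with
  | refl M => rfl
  | symm _ ih => exact (ih ρ).symm
  | trans _ _ ih₁ ih₂ => exact (ih₁ ρ).trans (ih₂ ρ)
  | lam _ ih => exact OrderHom.ext _ _ (funext fun x => ih (Env.cons x ρ))
  | app _ _ ih₁ ih₂ => rw [Term.eval_app, Term.eval_app, ih₁, ih₂]
  | beta M N => exact (M.eval_subst_singleSubst I N ρ).symm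
  | @eta _ σ τ M =>
    refine OrderHom.ext _ _ (funext fun x => ?_)
    have hM := congrArg (fun g : O (σ.arrow τ) => (show O σ →o O τ from g) x)
      (M.eval_weaken I x ρ)
    exact hM
  | ax h => exact hI h ρ

/-- `e m` is not definable in a calculus whose constants have an interpretation in the hierarchy
that validates the additional conversions. -/
theorem not_definable_e {L : Calculus} (I : ∀ σ, L.Const σ → O σ)
    (hI : ∀ {Γ : List Ty} {σ : Ty} {M N : Term L.Const Γ σ}, L.Ax M N →
      ∀ ρ, M.eval I ρ = N.eval I ρ)
    {α : Ty} {m : ℕ} (hm : Nat.card (O α) ≤ m) : ¬ Definable L α (unary (e m)) := by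
  rintro ⟨F, hF⟩
  let ρ : Env [] := fun _ v => nomatch v
  have key (n : ℕ) : (show O (numTy α) →o O (numTy α) from F.eval I ρ)
      ((numeral L.Const α n).eval I ρ) = (numeral L.Const α (e m n)).eval I ρ :=
    ((hF (fun _ => n) (e m n)).mp (Part.mem_some _)).eval_eq hI ρ
  have h1 := key m
  have h0 := key (m + (Nat.card (O α)).factorial)
  rw [eval_numeral_add_factorial I α hm, h1] at h0
  have hne : m + (Nat.card (O α)).factorial ≠ m := by
    have := Nat.factorial_pos (Nat.card (O α))
    omega
  rw [e, if_pos rfl, e, if_neg hne] at h0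
  exact eval_numeral_zero_ne_one I α ρ h0.symm

/-! ### Least elements and fixed points in the hierarchy -/

/-- The least element of `O σ`. -/
def bot : (σ : Ty) → O σ
  | .o => (false : Bool)
  | .arrow σ τ => (OrderHom.const (O σ) (bot τ) : O σ →o O τ)

theorem bot_le : (σ : Ty) → (x : O σ) → bot σ ≤ x
  | .o, x => Bool.false_le x
  | .arrow σ τ, x => fun y => bot_le τ ((show O σ →o O τ from x) y)

/-- The least fixed point operator on `O σ`: iteration from the least element, as many times as
`O σ` has elements. -/
noncomputable def fix (σ : Ty) : (O σ →o O σ) →o O σ where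
  toFun f := f^[Nat.card (O σ)] (bot σ)
  monotone' f _ hfg := f.monotone.iterate_le_of_le hfg _ _

theorem map_fix (σ : Ty) (f : O σ →o O σ) : f (fix σ f) = fix σ f :=
  have := finite_O σ
  show f (f^[Nat.card (O σ)] (bot σ)) = f^[Nat.card (O σ)] (bot σ) from
    isFixedPt_iterate_card f (bot_le σ)

/-- The recursion operators are interpreted by the least fixed point operators. -/
noncomputable def evalY : ∀ σ, YConst σ → O σ
  | _, .Y σ => fix σ

theorem eval_eq_of_YAx {Γ : List Ty} {σ : Ty} {M N : Term YConst Γ σ} (h : YAx M N) (ρ : Env Γ) :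
    M.eval evalY ρ = N.eval evalY ρ := by
  cases h with
  | unfold M => exact map_fix σ (M.eval evalY ρ)

end LambdaCalc

theorem fact1 (α : LambdaCalc.Ty) (m : ℕ) (hm : LambdaCalc.h (α.arrow α) < m) :
    ¬ LambdaCalc.Definable LambdaCalc.lambdaBetaEta α (LambdaCalc.unary (LambdaCalc.e m)) ∧
    ¬ LambdaCalc.Definable LambdaCalc.lambdaOmega α (LambdaCalc.unary (LambdaCalc.e m)) ∧
    ¬ LambdaCalc.Definable LambdaCalc.lambdaOmegaPlus α (LambdaCalc.unary (LambdaCalc.e m)) ∧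
    ¬ LambdaCalc.Definable LambdaCalc.lambdaY α (LambdaCalc.unary (LambdaCalc.e m)) := by
  have hN : Nat.card (LambdaCalc.O α) ≤ m := (LambdaCalc.card_le_h α).trans hm.le
  exact ⟨LambdaCalc.not_definable_e (L := LambdaCalc.lambdaBetaEta)
      (fun σ _ => LambdaCalc.bot σ) False.elim hN,
    LambdaCalc.not_definable_e (L := LambdaCalc.lambdaOmega)
      (fun σ _ => LambdaCalc.bot σ) False.elim hN,
    LambdaCalc.not_definable_e (L := LambdaCalc.lambdaOmegaPlus)
      (fun σ _ => LambdaCalc.bot σ) False.elim hN,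
    LambdaCalc.not_definable_e LambdaCalc.evalY LambdaCalc.eval_eq_of_YAx hN⟩
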